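/- Let $\mathfrak g$ be a finite-dimensional real semisimple Lie algebra, $\sigma$ a Cartan involution, $\mathfrak g=\mathfrak k\oplus\mathfrak p$ the decomposition into its $(+1)$- and $(-1)$-eigenspaces, $\mathfrak a$ a maximal abelian subspace of $\mathfrak p$, $\mathfrak g_\alpha=\{X\in\mathfrak g : [H,X]=\alpha(H)X \text{ for all } H\in\mathfrak a\}$ for $\alpha\in\mathfrak a^*$, and $\Delta=\{\alpha\neq 0 : \mathfrak g_\alpha\ne 0\}$ the set of restricted roots. Let $\Lambda=\{\alpha_1,\dots,\alpha_r\}$ be a set of simple roots of $\Delta$ and $H^1,\dots,H^r\in\mathfrak a$ its dual basis, $\alpha_i(H^j)=\delta_{ij}$. For $\Lambda'\subseteq\Lambda$ put $Z_{\Lambda'}=\sum_{\alpha_i\notin\Lambda'}H^i$ (the characteristic element of $\Lambda'$), let $\mathfrak a_{\Lambda'}$ be the span of the $H^i$ with $\alpha_i\notin\Lambda'$, let $\mathfrak g^k_{\Lambda'}=\sum_{\alpha\in\Delta,\ \alpha(Z_{\Lambda'})=k}\mathfrak g_\alpha$ for integers $k>0$, and put $\mathfrak n_{\Lambda'}=\sum_{k>0}\mathfrak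 g^k_{\Lambda'}$ and $\mathfrak s_{\Lambda'}=\mathfrak a_{\Lambda'}+\mathfrak n_{\Lambda'}$, which is a Lie subalgebra of $\mathfrak g$. A (left invariant) affine connection on a real Lie algebra $\mathfrak l$ is a bilinear map $\nabla:\mathfrak l\times\mathfrak l\to\mathfrak l$, $(X,Y)\mapsto\nabla_XY$. It is flat if $\nabla_XY-\nabla_YX=[X,Y]$ and $\nabla_X\nabla_YZ-\nabla_Y\nabla_XZ-\nabla_{[X,Y]}Z=0$ for all $X,Y,Z\in\mathfrak l$. A subalgebra $\mathfrak h\subseteq\mathfrak l$ is autoparallel for $\nabla$ if $\nabla_XY\in\mathfrak h$ for all $X,Y\in\mathfrak h$. **Proposition.** The Lie algebra $\mathfrak s_\emptyset$ equals $\mathfrak a+\mathfrak n_\emptyset$ and is solvable, and for every proper subset $\Lambda'\subsetneq\Lambda$ the Lie algebra $\mathfrak s_{\Lambda'}$ is a solvable subalgebra of $\mathfrak s_\emptyset$. There is exactly one affine connection $\nabla$ on $\mathfrak s_\emptyset$ such that - $\nabla_XY=0$ for $X,Y\in\mathfrak a$; - $\nabla_XY=\frac{j}{i+j}[X,Y]$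 for $X\in\mathfrak g^i_\emptyset$, $Y\in\mathfrak g^j_\emptyset$ with integers $i,j>0$; - $\nabla_XY=[X,Y]$ for $X\in\mathfrak a$, $Y\in\mathfrak n_\emptyset$; - $\nabla_XY=0$ for $X\in\mathfrak n_\emptyset$, $Y\in\mathfrak a$. This connection $\nabla$ is flat, and for every proper subset $\Lambda'\subsetneq\Lambda$ the subalgebra $\mathfrak s_{\Lambda'}$ of $(\mathfrak s_\emptyset,\nabla)$ is autoparallel. -/

import Mathlib

namespace ParabolicFlat

/-! ### Left invariant affine connections, on the level of the Lie algebra -/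

/-- A left invariant affine connection on a Lie group with Lie algebra `L`, given by its values
`∇_X Y` on left invariant vector fields: an arbitrary real bilinear map `L × L → L`. -/
abbrev Connection (L : Type*) [LieRing L] [LieAlgebra ℝ L] : Type _ := L →ₗ[ℝ] L →ₗ[ℝ] L

section Connection

variable {L : Type*} [LieRing L] [LieAlgebra ℝ L]

/-- The torsion `T(X, Y) = ∇_X Y - ∇_Y X - [X, Y]`. -/
def torsion (nabla : Connection L) (X Y : L) : L :=
  nabla X Y - nabla Y X - ⁅X, Y⁆

/-- The curvature `R(X, Y)Z = ∇_X ∇_Y Z - ∇_Y ∇_X Z - ∇_[X,Y] Z`. -/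
def curvature (nabla : Connection L) (X Y Z : L) : L :=
  nabla X (nabla Y Z) - nabla Y (nabla X Z) - nabla ⁅X, Y⁆ Z

/-- A flat affine connection: torsion-free with vanishing curvature. -/
structure IsFlatAffine (nabla : Connection L) : Prop where
  torsion_eq_zero : ∀ X Y, torsion nabla X Y = 0
  curvature_eq_zero : ∀ X Y Z, curvature nabla X Y Z = 0

/-- A Lie subalgebra `S` is autoparallel if `∇_X Y ∈ S` for all `X, Y ∈ S`. -/
def IsAutoparallel (nabla : Connection L) (S : LieSubalgebra ℝ L) : Prop :=
  ∀ X ∈ S, ∀ Y ∈ S, nabla X Y ∈ S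

end Connection

/-! ### Cartan involutions and restricted roots -/

variable {g : Type*} [LieRing g] [LieAlgebra ℝ g]

/-- A Cartan involution: an involutive automorphism `σ` such that `-B(X, σ Y)` is positive
definite, where `B` is the Killing form. -/
structure IsCartanInvolution (σ : g ≃ₗ⁅ℝ⁆ g) : Prop where
  involutive : ∀ X, σ (σ X) = X
  pos : ∀ X, X ≠ 0 → 0 < -(killingForm ℝ g X (σ X))

/-- `𝔞` is a maximal abelian subspace of the `(-1)`-eigenspace `𝔭` of `σ`. -/
structure IsMaximalAbelian (σ : g ≃ₗ⁅ℝ⁆ g) (a : Submodule ℝ g) : Prop where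
  le_p : ∀ X ∈ a, σ X = -X
  abelian : ∀ X ∈ a, ∀ Y ∈ a, ⁅X, Y⁆ = 0
  maximal : ∀ b : Submodule ℝ g, (∀ X ∈ b, σ X = -X) → (∀ X ∈ b, ∀ Y ∈ b, ⁅X, Y⁆ = 0) →
    a ≤ b → b = a

/-- The space `𝔤_α = {X | [H, X] = α(H) X for all H ∈ 𝔞}`; `𝔤_0` is the centralizer of `𝔞`. -/
def rootSpace (a : Submodule ℝ g) (α : Module.Dual ℝ a) : Submodule ℝ g where
  carrier := {X | ∀ H : a, ⁅(H : g), X⁆ = α H • X}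
  add_mem' hX hY H := by rw [lie_add, hX H, hY H, smul_add]
  zero_mem' H := by simp
  smul_mem' c X hX H := by rw [lie_smul, hX H, smul_comm]

/-- The restricted roots: the nonzero `α ∈ 𝔞^*` with `𝔤_α ≠ 0`. -/
def roots (a : Submodule ℝ g) : Set (Module.Dual ℝ a) :=
  {α | α ≠ 0 ∧ rootSpace a α ≠ ⊥}

/-- `α_1, …, α_r` is a set of simple roots: they are linearly independent roots, and each root is
a combination of them with integral coefficients, all `≥ 0` or all `≤ 0`. -/
structure IsSimpleSystem (a : Submodule ℝ g) {r : ℕ} (α : Fin r → Module.Dual ℝ a) : Prop where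
  mem_roots : ∀ i, α i ∈ roots a
  linearIndependent : LinearIndependent ℝ α
  sign : ∀ β ∈ roots a,
    (∃ c : Fin r → ℕ, β = ∑ i, c i • α i) ∨ (∃ c : Fin r → ℕ, β = -∑ i, c i • α i)

/-- `H^1, …, H^r` is dual to `α_1, …, α_r`, that is, `α_i(H^j) = δ_ij`. -/
def IsDualTo {a : Submodule ℝ g} {r : ℕ} (H : Fin r → a) (α : Fin r → Module.Dual ℝ a) : Prop :=
  ∀ i j, α i (H j) = if i = j then 1 else 0

/-! ### Gradations and the solvable subalgebras

The subset `Λ' = {α_i | i ∈ I}` of the set of simple roots is encoded by the set `I` of indices. -/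

/-- The characteristic element of `Λ'`: the sum of the `H^i` with `α_i ∉ Λ'`. -/
def charElement {a : Submodule ℝ g} {r : ℕ} (H : Fin r → a) (I : Finset (Fin r)) : a :=
  ∑ i ∈ Iᶜ, H i

/-- The piece `𝔤^k` of the gradation defined by `Z`, the sum of the `𝔤_α` with `α(Z) = k`, where
`α` is a restricted root or zero (so `𝔤_0 ⊆ 𝔤^0`). -/
def gradedPiece (a : Submodule ℝ g) (Z : a) (k : ℤ) : Submodule ℝ g :=
  ⨆ α ∈ {α : Module.Dual ℝ a | (α = 0 ∨ α ∈ roots a) ∧ α Z = (k : ℝ)}, rootSpace a α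

/-- The sum of the `𝔤^k` with `k > 0`. -/
def positivePart (a : Submodule ℝ g) (Z : a) : Submodule ℝ g :=
  ⨆ k ∈ {k : ℤ | 0 < k}, gradedPiece a Z k

/-- `𝔞_Λ'`, the span of the `H^i` with `α_i ∉ Λ'`. -/
def aPart {a : Submodule ℝ g} {r : ℕ} (H : Fin r → a) (I : Finset (Fin r)) : Submodule ℝ g :=
  Submodule.span ℝ {X | ∃ i, i ∉ I ∧ X = (H i : g)}

/-- `𝔫_Λ'`, the sum of the `𝔤^k`, `k > 0`, for the characteristic element of `Λ'`. -/
def nPart {a : Submodule ℝ g} {r : ℕ} (H : Fin r → a) (I : Finset (Fin r)) : Submodule ℝ g :=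
  positivePart a (charElement H I)

theorem aPart_le {a : Submodule ℝ g} {r : ℕ} (H : Fin r → a) (I : Finset (Fin r)) :
    aPart H I ≤ a := by
  refine Submodule.span_le.2 ?_
  rintro X ⟨i, -, rfl⟩
  exact (H i).2

theorem lie_mem_rootSpace (a : Submodule ℝ g) {α β : Module.Dual ℝ a} {X Y : g}
    (hX : X ∈ rootSpace a α) (hY : Y ∈ rootSpace a β) : ⁅X, Y⁆ ∈ rootSpace a (α + β) := by
  intro H
  rw [leibniz_lie, hX H, hY H, smul_lie, lie_smul, ← add_smul, LinearMap.add_apply]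

theorem rootSpace_le_positivePart (a : Submodule ℝ g) (Z : a) {α : Module.Dual ℝ a} {k : ℤ}
    (hk : 0 < k) (hα : α Z = (k : ℝ)) : rootSpace a α ≤ positivePart a Z := by
  by_cases h : rootSpace a α = ⊥
  · rw [h]; exact bot_le
  · have hα0 : α ≠ 0 := by
      rintro rfl
      have : (k : ℝ) = 0 := by rw [← hα]; rfl
      exact hk.ne' (by exact_mod_cast this)
    refine le_trans ?_ (le_iSup₂_of_le k hk le_rfl)
    exact le_iSup₂_of_le (f := fun α _ => rootSpace a α) α ⟨Or.inr ⟨hα0, h⟩, hα⟩ le_rfl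

theorem positivePart_induction {a : Submodule ℝ g} {Z : a} {P : g → Prop}
    (hroot : ∀ (k : ℤ) (α : Module.Dual ℝ a), 0 < k → α Z = (k : ℝ) →
      ∀ X ∈ rootSpace a α, P X)
    (hzero : P 0) (hadd : ∀ X Y, P X → P Y → P (X + Y)) {X : g}
    (hX : X ∈ positivePart a Z) : P X := by
  unfold positivePart at hX
  rw [iSup_subtype'] at hX
  refine Submodule.iSup_induction _ (motive := P) hX (fun k Y hY => ?_) hzero hadd
  unfold gradedPiece at hY
  rw [iSup_subtype'] at hY
  exact Submodule.iSup_induction _ (motive := P) hY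
    (fun α W hW => hroot k.1 α.1 k.2 α.2.2 W hW) hzero hadd

theorem lie_mem_positivePart {a : Submodule ℝ g} {Z : a} {X Y : g}
    (hX : X ∈ positivePart a Z) (hY : Y ∈ positivePart a Z) : ⁅X, Y⁆ ∈ positivePart a Z := by
  refine positivePart_induction (P := fun X => ⁅X, Y⁆ ∈ positivePart a Z) ?_ (by simp)
    (fun X X' h h' => by rw [add_lie]; exact add_mem h h') hX
  intro k α hk hα X hX
  refine positivePart_induction (P := fun Y => ⁅X, Y⁆ ∈ positivePart a Z) ?_ (by simp)
    (fun Y Y' h h' => by rw [lie_add]; exact add_mem h h') hY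
  intro l β hl hβ Y hY
  refine rootSpace_le_positivePart a Z (k := k + l) (add_pos hk hl) ?_ (lie_mem_rootSpace a hX hY)
  rw [LinearMap.add_apply, hα, hβ, Int.cast_add]

theorem lie_mem_positivePart_of_mem {a : Submodule ℝ g} {Z : a} {X Y : g}
    (hX : X ∈ a) (hY : Y ∈ positivePart a Z) : ⁅X, Y⁆ ∈ positivePart a Z := by
  refine positivePart_induction (P := fun Y => ⁅X, Y⁆ ∈ positivePart a Z) ?_ (by simp)
    (fun Y Y' h h' => by rw [lie_add]; exact add_mem h h') hY
  intro k α hk hα Y hY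
  rw [hY ⟨X, hX⟩]
  exact Submodule.smul_mem _ _ (rootSpace_le_positivePart a Z hk hα hY)

/-- The Lie subalgebra `𝔰_Λ' = 𝔞_Λ' + 𝔫_Λ'` of `𝔤`. -/
def sAlg {σ : g ≃ₗ⁅ℝ⁆ g} {a : Submodule ℝ g} (ha : IsMaximalAbelian σ a) {r : ℕ}
    (H : Fin r → a) (I : Finset (Fin r)) : LieSubalgebra ℝ g where
  toSubmodule := aPart H I ⊔ nPart H I
  lie_mem' := by
    intro X Y hX hY
    obtain ⟨A, hA, N, hN, rfl⟩ := Submodule.mem_sup.1 hX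
    obtain ⟨B, hB, M, hM, rfl⟩ := Submodule.mem_sup.1 hY
    have hA' := aPart_le H I hA
    have hB' := aPart_le H I hB
    refine Submodule.mem_sup_right (T := nPart H I) ?_
    rw [add_lie, lie_add, lie_add, ha.abelian A hA' B hB', zero_add, ← lie_skew N B]
    exact add_mem (lie_mem_positivePart_of_mem hA' hM)
      (add_mem (neg_mem (lie_mem_positivePart_of_mem hB' hN)) (lie_mem_positivePart hN hM))

/-- The connection on `𝔰_∅ = 𝔞 + 𝔫_∅` built from the gradation `𝔫_∅ = ∑_{k>0} 𝔤^k` defined by the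
characteristic element `Z = H^1 + ⋯ + H^r` of the empty set. -/
structure IsGradingConnection {σ : g ≃ₗ⁅ℝ⁆ g} {a : Submodule ℝ g} (ha : IsMaximalAbelian σ a)
    {r : ℕ} (H : Fin r → a) (nabla : Connection (sAlg ha H ∅)) : Prop where
  a_a : ∀ X Y : sAlg ha H ∅, (X : g) ∈ a → (Y : g) ∈ a → nabla X Y = 0
  graded : ∀ i j : ℤ, 0 < i → 0 < j → ∀ X Y : sAlg ha H ∅,
    (X : g) ∈ gradedPiece a (charElement H ∅) i → (Y : g) ∈ gradedPiece a (charElement H ∅) j →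
      nabla X Y = ((j : ℝ) / ((i : ℝ) + (j : ℝ))) • ⁅X, Y⁆
  a_n : ∀ X Y : sAlg ha H ∅, (X : g) ∈ a → (Y : g) ∈ nPart H ∅ → nabla X Y = ⁅X, Y⁆
  n_a : ∀ X Y : sAlg ha H ∅, (X : g) ∈ nPart H ∅ → (Y : g) ∈ a → nabla X Y = 0

end ParabolicFlat

open ParabolicFlat

/-!
Let `Z = H^1 + ⋯ + H^r`. On `𝔫 = 𝔫_∅` the operator `D = ad Z` has only positive eigenvalues, so it
is injective, hence by finite dimension bijective, on `𝔫` and on each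
`D`-invariant subspace of `𝔫`; it vanishes on `𝔞`. The connection is the adjoint representation conjugated by `D`:
`∇_X Y = D⁻¹ [X, D Y]`, which makes sense because `[𝔰, D 𝔰] ⊆ 𝔫`. Equivalently, `∇_X Y` is the
unique element of `𝔫` with `[Z, ∇_X Y] = [X, [Z, Y]]` (`IsGradingConnection.mem_and_lie`), and from
this description everything about the connection follows:

* the curvature vanishes because `D (R(X, Y) W)` is the Jacobi identity for `X`, `Y`, `D W`;
* the torsion vanishes because `D` is a derivation;
* `𝔰_Λ'` is autoparallel because `[𝔰_Λ', D 𝔰_Λ'] ⊆ 𝔫_Λ'` and `D` maps `𝔫_Λ'` onto itself.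

Solvability of `𝔰_∅` comes from the filtration of `𝔤` by the eigenvalues of `D`, which the derived
series descends, and the inclusion `𝔫_Λ' ⊆ 𝔫_∅` comes from the sign condition on roots.

The Cartan involution is used for `𝔞 = 𝔞_∅`: the operators `ad X` with `X ∈ 𝔞` are symmetric for
the inner product `-B(X, σ Y)` and commute, so `𝔤` is spanned by joint eigenvectors. An element of
`𝔞` on which all roots vanish is then central, hence zero (`eq_zero_of_forall_roots`), so the
simple roots span `𝔞^*` and the dual elements `H^i` span `𝔞`.
-/

namespace ParabolicFlat

open Module.End

variable {g : Type*} [LieRing g] [LieAlgebra ℝ g]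

/-! ### Restricted roots separate the points of `𝔞` -/

section Separation

variable {σ : g ≃ₗ⁅ℝ⁆ g}

/-- The inner product `-B(X, σ Y)` attached to a Cartan involution `σ`. -/
@[reducible]
noncomputable def IsCartanInvolution.innerCore (hσ : IsCartanInvolution σ) :
    InnerProductSpace.Core ℝ g where
  inner X Y := -(killingForm ℝ g X (σ Y))
  conj_inner_symm X Y := by
    have h := LieAlgebra.killingForm_of_equiv_apply σ X (σ Y)
    rw [hσ.involutive] at h
    rw [← h, LieModule.traceForm_comm]
    simp
  re_inner_nonneg X := by
    by_cases h : X = 0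
    · simp [h]
    · exact (hσ.pos X h).le
  add_left X Y W := by simp [add_comm]
  smul_left X Y c := by simp
  definite X h := by
    by_contra hX
    exact (hσ.pos X hX).ne' h

/-- `𝔤` is spanned by the joint eigenvectors of `ad X`, `X ∈ 𝔞`. -/
theorem iSup_iInf_eigenspace_ad_eq_top [FiniteDimensional ℝ g] (hσ : IsCartanInvolution σ)
    {a : Submodule ℝ g} (ha : IsMaximalAbelian σ a) :
    ⨆ χ : a → ℝ, ⨅ X : a, eigenspace (LieAlgebra.ad ℝ g (X : g)) (χ X) = ⊤ := by
  let := hσ.innerCore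
  let : NormedAddCommGroup g := InnerProductSpace.Core.toNormedAddCommGroup (𝕜 := ℝ)
  let : InnerProductSpace ℝ g := InnerProductSpace.ofCore hσ.innerCore.toCore
  refine LinearMap.IsSymmetric.iSup_iInf_eq_top_of_commute
    (T := fun X : a => (LieAlgebra.ad ℝ g (X : g) : g →ₗ[ℝ] g)) (fun X Y W => ?_)
    (fun X Y _ => ?_)
  · change -(killingForm ℝ g ⁅(X : g), Y⁆ (σ W)) = -(killingForm ℝ g Y (σ ⁅(X : g), W⁆))
    rw [LieModule.traceForm_apply_lie_apply', LieEquiv.map_lie, ha.le_p X X.2, neg_lie, map_neg]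
  · refine LinearMap.ext fun W => ?_
    change ⁅(X : g), ⁅(Y : g), W⁆⁆ = ⁅(Y : g), ⁅(X : g), W⁆⁆
    rw [leibniz_lie, ha.abelian X X.2 Y Y.2, zero_lie, zero_add]

theorem eq_zero_of_forall_roots [FiniteDimensional ℝ g] (hσ : IsCartanInvolution σ)
    {a : Submodule ℝ g} (ha : IsMaximalAbelian σ a) (X : a) (hX : ∀ β ∈ roots a, β X = 0) :
    X = 0 := by
  have had : LieAlgebra.ad ℝ g (X : g) = 0 := by
    rw [← LinearMap.ker_eq_top, eq_top_iff, ← iSup_iInf_eigenspace_ad_eq_top hσ ha]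
    refine iSup_le fun χ v hv => ?_
    simp only [Submodule.mem_iInf, mem_eigenspace_iff, LieAlgebra.ad_apply] at hv
    rw [LinearMap.mem_ker, LieAlgebra.ad_apply]
    by_cases hv0 : v = 0
    · rw [hv0, lie_zero]
    -- A joint eigenvalue with a nonzero eigenvector is automatically a linear form.
    let β : Module.Dual ℝ a :=
      { toFun := χ
        map_add' := fun Y W => smul_left_injective ℝ hv0 <| by
          change χ (Y + W) • v = (χ Y + χ W) • v
          rw [← hv, add_smul, ← hv, ← hv, Submodule.coe_add, add_lie]
        map_smul' := fun c Y => smul_left_injective ℝ hv0 <| by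
          change χ (c • Y) • v = (c • χ Y) • v
          rw [← hv, smul_assoc, ← hv, Submodule.coe_smul, smul_lie] }
    have hβ : β X = 0 := by
      by_cases h0 : β = 0
      · rw [h0, LinearMap.zero_apply]
      · exact hX β ⟨h0, (Submodule.ne_bot_iff _).2 ⟨v, hv, hv0⟩⟩
    rw [hv X, show χ X = 0 from hβ, zero_smul]
  -- `ad X = 0` makes `X` orthogonal to `σ X` for the Killing form, against positivity.
  by_contra h
  have h0 : (X : g) ≠ 0 := by simpa using h
  have := hσ.pos X h0
  rw [killingForm_apply_apply, had, LinearMap.zero_comp, map_zero, neg_zero] at this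
  exact this.false

/-- The dual basis of a simple system spans `𝔞`, that is, `𝔞_∅ = 𝔞`. -/
theorem aPart_empty [FiniteDimensional ℝ g] (hσ : IsCartanInvolution σ)
    {a : Submodule ℝ g} (ha : IsMaximalAbelian σ a) {r : ℕ} {α : Fin r → Module.Dual ℝ a}
    (hα : IsSimpleSystem a α) {H : Fin r → a} (hH : IsDualTo H α) : aPart H ∅ = a := by
  refine le_antisymm (aPart_le H ∅) fun X hX => ?_
  have hsimple : ∀ i, α i (⟨X, hX⟩ - ∑ j, α j ⟨X, hX⟩ • H j) = 0 := by
    intro i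
    simp [hH i]
  have hzero := eq_zero_of_forall_roots hσ ha (⟨X, hX⟩ - ∑ j, α j ⟨X, hX⟩ • H j) fun β hβ => by
    rcases hα.sign β hβ with ⟨c, rfl⟩ | ⟨c, rfl⟩
    · rw [LinearMap.sum_apply]
      exact Finset.sum_eq_zero fun i _ => by rw [LinearMap.smul_apply, hsimple, smul_zero]
    · rw [LinearMap.neg_apply, LinearMap.sum_apply, neg_eq_zero]
      exact Finset.sum_eq_zero fun i _ => by rw [LinearMap.smul_apply, hsimple, smul_zero]
  have hsum : X = ∑ j, α j ⟨X, hX⟩ • (H j : g) := by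
    have := congrArg (Subtype.val : a → g) (sub_eq_zero.1 hzero)
    simpa using this
  rw [hsum]
  exact Submodule.sum_mem _ fun j _ =>
    Submodule.smul_mem _ _ (Submodule.subset_span ⟨j, Finset.notMem_empty j, rfl⟩)

end Separation

/-! ### Eigenvalues of `ad Z` and solvability -/

/-- The sum of the eigenspaces of `ad Z` for the integral eigenvalues `k ≥ m`. -/
def eigenspacesFrom (Z : g) (m : ℤ) : Submodule ℝ g :=
  ⨆ k : {k : ℤ // m ≤ k}, eigenspace (LieAlgebra.ad ℝ g Z) ((k : ℤ) : ℝ)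

theorem mem_eigenspacesFrom {Z X : g} {m k : ℤ} (hk : m ≤ k) (hX : ⁅Z, X⁆ = (k : ℝ) • X) :
    X ∈ eigenspacesFrom Z m :=
  Submodule.mem_iSup_of_mem (p := fun k : {k : ℤ // m ≤ k} =>
    eigenspace (LieAlgebra.ad ℝ g Z) ((k : ℤ) : ℝ)) ⟨k, hk⟩ (mem_eigenspace_iff.2 hX)

theorem eigenspacesFrom_antitone (Z : g) : Antitone (eigenspacesFrom Z) := fun _ _ h =>
  iSup_le fun k _ hX => mem_eigenspacesFrom (h.trans k.2) (mem_eigenspace_iff.1 hX)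

theorem lie_mem_eigenspacesFrom {Z X Y : g} {m n : ℤ} (hX : X ∈ eigenspacesFrom Z m)
    (hY : Y ∈ eigenspacesFrom Z n) : ⁅X, Y⁆ ∈ eigenspacesFrom Z (m + n) := by
  refine Submodule.iSup_induction _ (motive := fun X => ⁅X, Y⁆ ∈ eigenspacesFrom Z (m + n)) hX
    (fun k X hX => ?_) (by simp) fun X X' h h' => by rw [add_lie]; exact add_mem h h'
  refine Submodule.iSup_induction _ (motive := fun Y => ⁅X, Y⁆ ∈ eigenspacesFrom Z (m + n)) hY
    (fun l Y hY => ?_) (by simp) fun Y Y' h h' => by rw [lie_add]; exact add_mem h h'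
  rw [mem_eigenspace_iff, LieAlgebra.ad_apply] at hX hY
  refine mem_eigenspacesFrom (add_le_add k.2 l.2) ?_
  rw [leibniz_lie, hX, hY, smul_lie, lie_smul, ← add_smul, Int.cast_add]

theorem exists_eigenspacesFrom_eq_bot [FiniteDimensional ℝ g] (Z : g) :
    ∃ n : ℕ, eigenspacesFrom Z n = ⊥ := by
  obtain ⟨M, hM⟩ := (finite_hasEigenvalue (LieAlgebra.ad ℝ g Z)).bddAbove
  obtain ⟨n, hn⟩ := exists_nat_gt M
  refine ⟨n, iSup_eq_bot.2 fun k => ?_⟩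
  by_contra h
  have h1 : ((k : ℤ) : ℝ) ≤ M := hM (hasEigenvalue_iff.2 h)
  have h2 : ((n : ℤ) : ℝ) ≤ ((k : ℤ) : ℝ) := Int.cast_le.2 k.2
  rw [Int.cast_natCast] at h2
  linarith

theorem positivePart_le_eigenspacesFrom (a : Submodule ℝ g) (Z : a) :
    positivePart a Z ≤ eigenspacesFrom (Z : g) 1 := fun _ hX =>
  positivePart_induction (P := fun X => X ∈ eigenspacesFrom (Z : g) 1)
    (fun _ _ hk hα X hX => mem_eigenspacesFrom hk (by rw [hX Z, hα])) (zero_mem _)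
    (fun _ _ => add_mem) hX

/-- `ad Z` is injective on the sum of the eigenspaces with positive eigenvalue. -/
theorem eq_zero_of_mem_positivePart {a : Submodule ℝ g} {Z : a} {X : g}
    (hX : X ∈ positivePart a Z) (h : ⁅(Z : g), X⁆ = 0) : X = 0 := by
  have hdisj := (eigenspaces_iSupIndep (LieAlgebra.ad ℝ g (Z : g))) 0
  refine Submodule.disjoint_def.1 hdisj X (mem_eigenspace_iff.2 (by rw [zero_smul]; exact h)) ?_
  refine (iSup_le fun k => ?_ : eigenspacesFrom (Z : g) 1 ≤ _)
    (positivePart_le_eigenspacesFrom a Z hX)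
  have hk : ((k : ℤ) : ℝ) ≠ 0 := by
    have := k.2
    exact_mod_cast (by lia : (k : ℤ) ≠ 0)
  exact le_iSup₂_of_le (f := fun (μ : ℝ) (_ : μ ≠ 0) =>
    eigenspace (LieAlgebra.ad ℝ g (Z : g)) μ) _ hk le_rfl

theorem eq_of_mem_positivePart {a : Submodule ℝ g} {Z : a} {X Y : g}
    (hX : X ∈ positivePart a Z) (hY : Y ∈ positivePart a Z) (h : ⁅(Z : g), X⁆ = ⁅(Z : g), Y⁆) :
    X = Y :=
  sub_eq_zero.1 (eq_zero_of_mem_positivePart (sub_mem hX hY) (by rw [lie_sub, h, sub_self]))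

/-- `ad Z` maps each of its invariant subspaces of the positive part onto itself. -/
theorem exists_lie_eq_of_mem [FiniteDimensional ℝ g] {a : Submodule ℝ g} {Z : a}
    {N : Submodule ℝ g} (hN : N ≤ positivePart a Z) (hinv : ∀ X ∈ N, ⁅(Z : g), X⁆ ∈ N)
    {X : g} (hX : X ∈ N) : ∃ Y ∈ N, ⁅(Z : g), Y⁆ = X := by
  have hinj : Function.Injective ((LieAlgebra.ad ℝ g (Z : g)).restrict hinv) := by
    intro Y W h
    exact Subtype.ext (eq_of_mem_positivePart (hN Y.2) (hN W.2) (congrArg Subtype.val h))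
  obtain ⟨Y, hY⟩ := LinearMap.surjective_of_injective hinj ⟨X, hX⟩
  exact ⟨Y, Y.2, congrArg Subtype.val hY⟩

theorem isSolvable_of_lie_mem_positivePart [FiniteDimensional ℝ g] {a : Submodule ℝ g} {Z : a}
    (S : LieSubalgebra ℝ g) (hS : ∀ X ∈ S, ∀ Y ∈ S, ⁅X, Y⁆ ∈ positivePart a Z) :
    LieAlgebra.IsSolvable S := by
  obtain ⟨n, hn⟩ := exists_eigenspacesFrom_eq_bot (Z : g)
  have key : ∀ k : ℕ, ∀ X ∈ LieAlgebra.derivedSeries ℝ S (k + 1),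
      (X : g) ∈ eigenspacesFrom (Z : g) (k + 1 : ℕ) := by
    intro k
    suffices h : (LieAlgebra.derivedSeries ℝ S (k + 1)).toSubmodule ≤
        (eigenspacesFrom (Z : g) (k + 1 : ℕ)).comap S.toSubmodule.subtype from fun X hX => h hX
    induction k with
    | zero =>
      rw [LieAlgebra.derivedSeries_def, LieAlgebra.derivedSeriesOfIdeal_succ,
        LieSubmodule.lieIdeal_oper_eq_linear_span', Submodule.span_le]
      rintro _ ⟨X, -, Y, -, rfl⟩
      exact positivePart_le_eigenspacesFrom a Z (hS X X.2 Y Y.2)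
    | succ k ih =>
      rw [LieAlgebra.derivedSeries_def, LieAlgebra.derivedSeriesOfIdeal_succ,
        LieSubmodule.lieIdeal_oper_eq_linear_span', Submodule.span_le]
      rintro _ ⟨X, hX, Y, hY, rfl⟩
      exact eigenspacesFrom_antitone (Z : g) (by push_cast; lia)
        (lie_mem_eigenspacesFrom (ih hX) (ih hY))
  refine LieAlgebra.IsSolvable.mk (R := ℝ) (k := n + 1) ((LieSubmodule.eq_bot_iff _).2 ?_)
  intro X hX
  have h := eigenspacesFrom_antitone (Z : g) (by push_cast; lia : (n : ℤ) ≤ (n + 1 : ℕ)) (key n X hX)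
  rw [hn, Submodule.mem_bot] at h
  exact Subtype.ext h

/-! ### The subalgebras `𝔰_Λ'` -/

theorem mem_sAlg {σ : g ≃ₗ⁅ℝ⁆ g} {a : Submodule ℝ g} (ha : IsMaximalAbelian σ a) {r : ℕ}
    {H : Fin r → a} {I : Finset (Fin r)} {X : g} :
    X ∈ sAlg ha H I ↔ ∃ A ∈ aPart H I, ∃ N ∈ nPart H I, A + N = X :=
  Submodule.mem_sup

theorem lie_mem_nPart {σ : g ≃ₗ⁅ℝ⁆ g} {a : Submodule ℝ g} (ha : IsMaximalAbelian σ a) {r : ℕ}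
    {H : Fin r → a} {I : Finset (Fin r)} {X Y : g} (hX : X ∈ sAlg ha H I)
    (hY : Y ∈ sAlg ha H I) : ⁅X, Y⁆ ∈ nPart H I := by
  obtain ⟨A, hA, N, hN, rfl⟩ := (mem_sAlg ha).1 hX
  obtain ⟨B, hB, M, hM, rfl⟩ := (mem_sAlg ha).1 hY
  have hA' := aPart_le H I hA
  have hB' := aPart_le H I hB
  rw [add_lie, lie_add, lie_add, ha.abelian A hA' B hB', zero_add, ← lie_skew N B]
  exact add_mem (lie_mem_positivePart_of_mem hA' hM)
    (add_mem (neg_mem (lie_mem_positivePart_of_mem hB' hN)) (lie_mem_positivePart hN hM))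

theorem lie_mem_nPart_of_mem {σ : g ≃ₗ⁅ℝ⁆ g} {a : Submodule ℝ g} (ha : IsMaximalAbelian σ a)
    {r : ℕ} {H : Fin r → a} {I : Finset (Fin r)} (Z : a) {X : g} (hX : X ∈ sAlg ha H I) :
    ⁅(Z : g), X⁆ ∈ nPart H I := by
  obtain ⟨A, hA, N, hN, rfl⟩ := (mem_sAlg ha).1 hX
  rw [lie_add, ha.abelian Z Z.2 A (aPart_le H I hA), zero_add]
  exact lie_mem_positivePart_of_mem Z.2 hN

theorem sum_smul_charElement {a : Submodule ℝ g} {r : ℕ} {α : Fin r → Module.Dual ℝ a}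
    {H : Fin r → a} (hH : IsDualTo H α) (I : Finset (Fin r)) (c : Fin r → ℕ) :
    (∑ i, c i • α i) (charElement H I) = ((∑ i ∈ Iᶜ, c i : ℕ) : ℝ) := by
  have h : ∀ i, α i (charElement H I) = if i ∈ Iᶜ then 1 else 0 := by
    intro i
    rw [charElement, map_sum, Finset.sum_congr rfl fun j _ => hH i j, Finset.sum_ite_eq]
  rw [LinearMap.sum_apply]
  simp only [LinearMap.smul_apply, h, smul_ite, smul_zero, Finset.sum_ite_mem, Finset.univ_inter]
  simp

/-- A root that is positive on `Z_Λ'` is a nonnegative combination of simple roots, so it is also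
positive on `Z_∅`. -/
theorem nPart_le_nPart_empty {a : Submodule ℝ g} {r : ℕ} {α : Fin r → Module.Dual ℝ a}
    (hα : IsSimpleSystem a α) {H : Fin r → a} (hH : IsDualTo H α) (I : Finset (Fin r)) :
    nPart H I ≤ nPart H ∅ := fun X hX => by
  refine positivePart_induction (P := fun X => X ∈ nPart H ∅) ?_ (zero_mem _)
    (fun _ _ => add_mem) hX
  intro k β hk hβ X hX
  by_cases hX0 : X = 0
  · rw [hX0]; exact zero_mem _
  have hk' : (0 : ℝ) < k := Int.cast_pos.2 hk
  have hroot : β ∈ roots a := by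
    refine ⟨?_, (Submodule.ne_bot_iff _).2 ⟨X, hX, hX0⟩⟩
    rintro rfl
    exact hk'.ne hβ
  rcases hα.sign β hroot with ⟨c, rfl⟩ | ⟨c, rfl⟩
  · rw [sum_smul_charElement hH] at hβ
    rw [← hβ, Nat.cast_pos] at hk'
    refine rootSpace_le_positivePart a _ (k := ((∑ i ∈ (∅ : Finset (Fin r))ᶜ, c i : ℕ) : ℤ)) ?_
      (by rw [sum_smul_charElement hH, Int.cast_natCast]) hX
    refine Int.natCast_pos.2 (hk'.trans_le (Finset.sum_le_sum_of_subset ?_))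
    rw [Finset.compl_empty]
    exact Finset.subset_univ _
  · rw [LinearMap.neg_apply, sum_smul_charElement hH] at hβ
    have : (0 : ℝ) ≤ ((∑ i ∈ Iᶜ, c i : ℕ) : ℝ) := Nat.cast_nonneg _
    linarith

theorem sAlg_le_sAlg_empty {σ : g ≃ₗ⁅ℝ⁆ g} {a : Submodule ℝ g} (ha : IsMaximalAbelian σ a) {r : ℕ}
    {α : Fin r → Module.Dual ℝ a} (hα : IsSimpleSystem a α) {H : Fin r → a} (hH : IsDualTo H α)
    (I : Finset (Fin r)) : sAlg ha H I ≤ sAlg ha H ∅ := by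
  have h : aPart H I ≤ aPart H ∅ := by
    refine Submodule.span_mono ?_
    rintro X ⟨i, -, hi⟩
    exact ⟨i, Finset.notMem_empty i, hi⟩
  exact sup_le_sup h (nPart_le_nPart_empty hα hH I)

/-! ### The grading connection -/

section Connection

variable {σ : g ≃ₗ⁅ℝ⁆ g} {a : Submodule ℝ g} {ha : IsMaximalAbelian σ a} {r : ℕ} {H : Fin r → a}

theorem lie_of_mem_gradedPiece {Z : a} {k : ℤ} {X : g} (hX : X ∈ gradedPiece a Z k) :
    ⁅(Z : g), X⁆ = (k : ℝ) • X := by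
  suffices h : gradedPiece a Z k ≤ eigenspace (LieAlgebra.ad ℝ g (Z : g)) (k : ℝ) from
    mem_eigenspace_iff.1 (h hX)
  refine iSup₂_le fun β hβ Y hY => mem_eigenspace_iff.2 ?_
  rw [LieAlgebra.ad_apply, hY Z, hβ.2]

theorem gradedPiece_le_positivePart (Z : a) {k : ℤ} (hk : 0 < k) :
    gradedPiece a Z k ≤ positivePart a Z :=
  le_iSup₂_of_le (f := fun (k : ℤ) (_ : k ∈ {k : ℤ | 0 < k}) => gradedPiece a Z k) k hk le_rfl

/-- Induction on the elements of `𝔰_∅`, which are sums of elements of `𝔞` and of the graded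
pieces. -/
theorem sAlg_induction {P : sAlg ha H ∅ → Prop} (hadd : ∀ X Y, P X → P Y → P (X + Y))
    (hA : ∀ X : sAlg ha H ∅, (X : g) ∈ a → P X)
    (hgr : ∀ k : ℤ, 0 < k → ∀ X : sAlg ha H ∅, (X : g) ∈ gradedPiece a (charElement H ∅) k → P X)
    (X : sAlg ha H ∅) : P X := by
  have hn : ∀ Y ∈ nPart H ∅, ∃ h : Y ∈ sAlg ha H ∅, P ⟨Y, h⟩ := by
    intro Y hY
    unfold nPart positivePart at hY
    rw [iSup_subtype'] at hY
    refine Submodule.iSup_induction _ (motive := fun Y => ∃ h : Y ∈ sAlg ha H ∅, P ⟨Y, h⟩) hY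
      (fun k Y hY => ?_) ⟨zero_mem _, hA _ (zero_mem a)⟩ ?_
    · exact ⟨Submodule.mem_sup_right (gradedPiece_le_positivePart _ k.2 hY), hgr k k.2 _ hY⟩
    · rintro Y W ⟨h, hP⟩ ⟨h', hP'⟩
      exact ⟨add_mem h h', hadd _ _ hP hP'⟩
  obtain ⟨X, hX⟩ := X
  obtain ⟨A, hA', N, hN, rfl⟩ := (mem_sAlg ha).1 hX
  obtain ⟨h, hP⟩ := hn N hN
  exact hadd ⟨A, Submodule.mem_sup_left hA'⟩ ⟨N, h⟩ (hA _ (aPart_le H ∅ hA')) hP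

/-- The defining conditions on `∇` say that `∇_X Y` is the element of `𝔫_∅` that `ad Z` maps to
`[X, [Z, Y]]`. -/
theorem IsGradingConnection.mem_and_lie {nabla : Connection (sAlg ha H ∅)}
    (hn : IsGradingConnection ha H nabla) (X Y : sAlg ha H ∅) :
    (nabla X Y : g) ∈ nPart H ∅ ∧
      ⁅((charElement H ∅ : a) : g), (nabla X Y : g)⁆ =
        ⁅(X : g), ⁅((charElement H ∅ : a) : g), (Y : g)⁆⁆ := by
  set Z : a := charElement H ∅ with hZ
  induction X using sAlg_induction with
  | hadd X X' h h' =>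
    rw [map_add, LinearMap.add_apply, AddMemClass.coe_add, AddMemClass.coe_add, lie_add,
      add_lie, h.2, h'.2]
    exact ⟨add_mem h.1 h'.1, rfl⟩
  | hA X hX =>
    induction Y using sAlg_induction with
    | hadd Y Y' h h' =>
      rw [map_add, AddMemClass.coe_add, AddMemClass.coe_add, lie_add, lie_add, lie_add,
        h.2, h'.2]
      exact ⟨add_mem h.1 h'.1, rfl⟩
    | hA Y hY =>
      rw [hn.a_a X Y hX hY, ha.abelian Z Z.2 Y hY]
      exact ⟨zero_mem _, by simp⟩
    | hgr j hj Y hY =>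
      rw [hn.a_n X Y hX (gradedPiece_le_positivePart _ hj hY)]
      refine ⟨lie_mem_nPart ha X.2 Y.2, ?_⟩
      rw [LieSubalgebra.coe_bracket, leibniz_lie, ha.abelian Z Z.2 X hX, zero_lie, zero_add]
  | hgr i hi X hX =>
    induction Y using sAlg_induction with
    | hadd Y Y' h h' =>
      rw [map_add, AddMemClass.coe_add, AddMemClass.coe_add, lie_add, lie_add, lie_add,
        h.2, h'.2]
      exact ⟨add_mem h.1 h'.1, rfl⟩
    | hA Y hY =>
      rw [hn.n_a X Y (gradedPiece_le_positivePart _ hi hX) hY, ha.abelian Z Z.2 Y hY]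
      exact ⟨zero_mem _, by simp⟩
    | hgr j hj Y hY =>
      have hij : (i : ℝ) + j ≠ 0 := by exact_mod_cast (by lia : i + j ≠ 0)
      rw [hn.graded i j hi hj X Y hX hY]
      refine ⟨Submodule.smul_mem _ _ (lie_mem_nPart ha X.2 Y.2), ?_⟩
      rw [SetLike.val_smul, LieSubalgebra.coe_bracket, lie_smul, leibniz_lie,
        lie_of_mem_gradedPiece hX, lie_of_mem_gradedPiece hY, smul_lie, lie_smul, ← add_smul,
        smul_smul, div_mul_cancel₀ _ hij]

/-- Conversely, a connection with values in `𝔫_∅` and `[Z, ∇_X Y] = [X, [Z, Y]]` satisfies the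
defining conditions. -/
theorem isGradingConnection_of_mem_of_lie {nabla : Connection (sAlg ha H ∅)}
    (hmem : ∀ X Y, (nabla X Y : g) ∈ nPart H ∅)
    (hlie : ∀ X Y, ⁅((charElement H ∅ : a) : g), (nabla X Y : g)⁆ =
      ⁅(X : g), ⁅((charElement H ∅ : a) : g), (Y : g)⁆⁆) :
    IsGradingConnection ha H nabla := by
  set Z : a := charElement H ∅ with hZ
  have hzero : ∀ X Y : sAlg ha H ∅, (Y : g) ∈ a → nabla X Y = 0 := fun X Y hY =>
    Subtype.ext <| eq_zero_of_mem_positivePart (hmem X Y) <| by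
      rw [← hZ, hlie, ha.abelian Z Z.2 Y hY, lie_zero]
  refine ⟨fun X Y _ hY => hzero X Y hY, fun i j hi hj X Y hX hY => ?_, fun X Y hX _ => ?_,
    fun X Y _ hY => hzero X Y hY⟩
  · have hij : (i : ℝ) + j ≠ 0 := by exact_mod_cast (by lia : i + j ≠ 0)
    refine Subtype.ext <| eq_of_mem_positivePart (hmem X Y)
      (Submodule.smul_mem _ _ (lie_mem_nPart ha X.2 Y.2)) ?_
    rw [← hZ, hlie, SetLike.val_smul, LieSubalgebra.coe_bracket, lie_smul,
      leibniz_lie (Z : g), lie_of_mem_gradedPiece hX, lie_of_mem_gradedPiece hY, smul_lie, lie_smul, ← add_smul, smul_smul,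
      div_mul_cancel₀ _ hij]
  · refine Subtype.ext <| eq_of_mem_positivePart (hmem X Y) (lie_mem_nPart ha X.2 Y.2) ?_
    rw [← hZ, hlie, LieSubalgebra.coe_bracket, leibniz_lie (Z : g), ha.abelian Z Z.2 X hX,
      zero_lie, zero_add]

theorem IsGradingConnection.unique {nabla nabla' : Connection (sAlg ha H ∅)}
    (hn : IsGradingConnection ha H nabla) (hn' : IsGradingConnection ha H nabla') :
    nabla = nabla' := by
  refine LinearMap.ext₂ fun X Y => Subtype.ext ?_
  have h := hn.mem_and_lie X Y
  have h' := hn'.mem_and_lie X Y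
  exact eq_of_mem_positivePart h.1 h'.1 (h.2.trans h'.2.symm)

variable (ha H) in
theorem exists_isGradingConnection [FiniteDimensional ℝ g] :
    ∃ nabla : Connection (sAlg ha H ∅), IsGradingConnection ha H nabla := by
  set Z : a := charElement H ∅ with hZ
  have hex : ∀ X Y : sAlg ha H ∅, ∃ W : sAlg ha H ∅, (W : g) ∈ nPart H ∅ ∧
      ⁅(Z : g), (W : g)⁆ = ⁅(X : g), ⁅(Z : g), (Y : g)⁆⁆ := by
    intro X Y
    obtain ⟨W, hW, h⟩ := exists_lie_eq_of_mem (Z := Z) (N := nPart H ∅) le_rfl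
      (fun X hX => lie_mem_positivePart_of_mem Z.2 hX)
      (lie_mem_nPart ha X.2 (Submodule.mem_sup_right (lie_mem_nPart_of_mem ha Z Y.2)))
    exact ⟨⟨W, Submodule.mem_sup_right hW⟩, hW, h⟩
  choose F hF hFZ using hex
  refine ⟨LinearMap.mk₂ ℝ F (fun X X' Y => ?_) (fun c X Y => ?_) (fun X Y Y' => ?_)
    (fun c X Y => ?_), isGradingConnection_of_mem_of_lie hF hFZ⟩
  · refine Subtype.ext <| eq_of_mem_positivePart (hF _ _) (add_mem (hF X Y) (hF X' Y)) ?_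
    rw [← hZ, AddMemClass.coe_add, lie_add, hFZ, hFZ, hFZ, AddMemClass.coe_add, add_lie]
  · refine Subtype.ext <| eq_of_mem_positivePart (hF _ _) (Submodule.smul_mem _ c (hF X Y)) ?_
    rw [← hZ, SetLike.val_smul, lie_smul, hFZ, hFZ, SetLike.val_smul, smul_lie]
  · refine Subtype.ext <| eq_of_mem_positivePart (hF _ _) (add_mem (hF X Y) (hF X Y')) ?_
    rw [← hZ, AddMemClass.coe_add, lie_add, hFZ, hFZ, hFZ, AddMemClass.coe_add, lie_add, lie_add]
  · refine Subtype.ext <| eq_of_mem_positivePart (hF _ _) (Submodule.smul_mem _ c (hF X Y)) ?_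
    rw [← hZ, SetLike.val_smul, lie_smul, hFZ, hFZ, SetLike.val_smul, lie_smul, lie_smul]

theorem IsGradingConnection.isFlatAffine {nabla : Connection (sAlg ha H ∅)}
    (hn : IsGradingConnection ha H nabla) : IsFlatAffine nabla where
  torsion_eq_zero X Y := by
    refine Subtype.ext <| eq_zero_of_mem_positivePart
      (sub_mem (sub_mem (hn.mem_and_lie X Y).1 (hn.mem_and_lie Y X).1)
        (lie_mem_nPart ha X.2 Y.2)) ?_
    rw [torsion, AddSubgroupClass.coe_sub, AddSubgroupClass.coe_sub, LieSubalgebra.coe_bracket,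
      lie_sub, lie_sub, (hn.mem_and_lie X Y).2, (hn.mem_and_lie Y X).2, leibniz_lie _ (X : g),
      ← lie_skew (Y : g)]
    abel
  curvature_eq_zero X Y W := by
    refine Subtype.ext <| eq_zero_of_mem_positivePart
      (sub_mem (sub_mem (hn.mem_and_lie X (nabla Y W)).1 (hn.mem_and_lie Y (nabla X W)).1)
        (hn.mem_and_lie ⁅X, Y⁆ W).1) ?_
    rw [curvature, AddSubgroupClass.coe_sub, AddSubgroupClass.coe_sub,
      lie_sub, lie_sub, (hn.mem_and_lie X (nabla Y W)).2, (hn.mem_and_lie Y (nabla X W)).2,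
      (hn.mem_and_lie ⁅X, Y⁆ W).2, (hn.mem_and_lie Y W).2, (hn.mem_and_lie X W).2,
      LieSubalgebra.coe_bracket, lie_lie, sub_self]

theorem IsGradingConnection.isAutoparallel [FiniteDimensional ℝ g]
    {α : Fin r → Module.Dual ℝ a} (hα : IsSimpleSystem a α) (hH : IsDualTo H α)
    {nabla : Connection (sAlg ha H ∅)} (hn : IsGradingConnection ha H nabla)
    (I : Finset (Fin r)) :
    IsAutoparallel nabla ((sAlg ha H I).comap (sAlg ha H ∅).incl) := by
  intro X hX Y hY
  set Z : a := charElement H ∅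
  have hle := nPart_le_nPart_empty hα hH I
  obtain ⟨W, hW, h⟩ := exists_lie_eq_of_mem (Z := Z) hle
    (fun X hX => lie_mem_positivePart_of_mem Z.2 hX)
    (lie_mem_nPart ha (I := I) hX (Submodule.mem_sup_right (lie_mem_nPart_of_mem ha Z hY)))
  have hXY := hn.mem_and_lie X Y
  have heq : (nabla X Y : g) = W :=
    eq_of_mem_positivePart hXY.1 (hle hW) (hXY.2.trans h.symm)
  change (nabla X Y : g) ∈ sAlg ha H I
  rw [heq]
  exact Submodule.mem_sup_right hW

end Connection

end ParabolicFlat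


theorem mainTheorem7 {g : Type*} [LieRing g] [LieAlgebra ℝ g] [FiniteDimensional ℝ g]
    [LieAlgebra.IsSemisimple ℝ g]
    (σ : g ≃ₗ⁅ℝ⁆ g) (hσ : IsCartanInvolution σ)
    (a : Submodule ℝ g) (ha : IsMaximalAbelian σ a)
    {r : ℕ} (α : Fin r → Module.Dual ℝ a) (hα : IsSimpleSystem a α)
    (H : Fin r → a) (hH : IsDualTo H α) :
    (sAlg ha H ∅).toSubmodule = a ⊔ nPart H ∅ ∧
    LieAlgebra.IsSolvable (sAlg ha H ∅) ∧
    (∀ I : Finset (Fin r), I ≠ Finset.univ →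
      LieAlgebra.IsSolvable (sAlg ha H I) ∧ sAlg ha H I ≤ sAlg ha H ∅) ∧
    (∃! nabla : Connection (sAlg ha H ∅), IsGradingConnection ha H nabla) ∧
    ∀ nabla : Connection (sAlg ha H ∅), IsGradingConnection ha H nabla →
      IsFlatAffine nabla ∧
      ∀ I : Finset (Fin r), I ≠ Finset.univ →
        IsAutoparallel nabla ((sAlg ha H I).comap (sAlg ha H ∅).incl) := by
  have hsolv : ∀ I : Finset (Fin r), LieAlgebra.IsSolvable (sAlg ha H I) := fun I =>
    isSolvable_of_lie_mem_positivePart (sAlg ha H I) fun X hX Y hY => lie_mem_nPart ha hX hY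
  refine ⟨?_, hsolv ∅, fun I _ => ⟨hsolv I, sAlg_le_sAlg_empty ha hα hH I⟩, ?_,
    fun nabla hn => ⟨hn.isFlatAffine, fun I _ => hn.isAutoparallel hα hH I⟩⟩
  · change aPart H ∅ ⊔ nPart H ∅ = a ⊔ nPart H ∅
    rw [aPart_empty hσ ha hα hH]
  · obtain ⟨nabla, hn⟩ := exists_isGradingConnection ha H
    exact ⟨nabla, hn, fun nabla' hn' => hn'.unique hn⟩
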